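/- Let $A\in\mathbb R^{n\times n}$, $B\in\mathbb R^{n\times p}$, $C\in\mathbb R^{m\times n}$, and let $\|\cdot\|$, $\langle\cdot,\cdot\rangle$ be the Euclidean norm and inner product. For $0<T\le\infty$, an initial state $\xi\in\mathbb R^n$ and a control $u\in L^2((0,T);\mathbb R^p)$, let $x$ be the corresponding continuous solution of $x'=Ax+Bu$, $x(0)=\xi$, that is, $x(t)=\xi+\int_0^t\big(Ax(s)+Bu(s)\big)\,ds$ for all finite $t\in[0,T]$, and set $$V_T(\xi)=\inf_{u\in L^2((0,T);\mathbb R^p)}\int_0^T\big(\|Cx(s)\|^2+\|u(s)\|^2\big)\,ds\in[0,\infty].$$ Assume the finite cost condition: for every $\xi\in\mathbb R^n$ there exists $u\in L^2((0,\infty);\mathbb R^p)$ such that $\int_0^\infty(\|Cx\|^2+\|u\|^2)\,ds<\infty$, where $x'=Ax+Bu$ and $x(0)=\xi$. Then there exists a unique symmetric matrix $P\in\mathbb R^{n\times n}$ such that $$\langle P\xi,\xi\rangle=V_\infty(\xi)<\infty\qquad\text{for all }\xi\in\mathbb R^n,$$ and the following hold. 1. For every $0<T<\infty$ there is a symmetric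 matrix $P_T\in\mathbb R^{n\times n}$ such that $\langle P_T\xi,\xi\rangle=V_T(\xi)<\infty$ for all $\xi\in\mathbb R^n$, and $P_T\to P$ as $T\to+\infty$. 2. For every $\xi\in\mathbb R^n$ the infimum that defines $V_\infty(\xi)$ is attained at a unique control $\widetilde u\in L^2((0,\infty);\mathbb R^p)$, with a unique corresponding solution $\widetilde x$, and $\widetilde u=-B^\top P\widetilde x$ almost everywhere in $[0,\infty)$. 3. $P$ satisfies the algebraic Riccati equation $$A^\top P+PA-PBB^\top P+C^\top C=0.$$ -/

import Mathlib

open MeasureTheory Set Filter Topology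
open scoped Matrix ENNReal

/-- The action `x ↦ M x` of a real `k × l` matrix, as a map between Euclidean spaces. -/
noncomputable def matAct {k l : ℕ} (M : Matrix (Fin k) (Fin l) ℝ) (x : EuclideanSpace ℝ (Fin l)) :
    EuclideanSpace ℝ (Fin k) :=
  WithLp.toLp 2 (M *ᵥ x.ofLp)

/-- `LQ.IsSolution A B I ξ u x`, for a time interval `I` that starts at `0` (`Icc 0 T` or `Ici 0`):
the control `u` is in `L²(I; ℝᵖ)`, and `x` is the continuous solution on `I` of
`x' = A x + B u`, `x(0) = ξ`, in the integrated sense. The values of `u` and `x` at times outside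
`I` are irrelevant. -/
structure LQ.IsSolution {n p : ℕ} (A : Matrix (Fin n) (Fin n) ℝ) (B : Matrix (Fin n) (Fin p) ℝ)
    (I : Set ℝ) (ξ : EuclideanSpace ℝ (Fin n))
    (u : ℝ → EuclideanSpace ℝ (Fin p)) (x : ℝ → EuclideanSpace ℝ (Fin n)) : Prop where
  memLp : MemLp u 2 (volume.restrict I)
  continuousOn : ContinuousOn x I
  eq_integral : ∀ t ∈ I, x t = ξ + ∫ s in (0 : ℝ)..t, (matAct A (x s) + matAct B (u s))

/-- The quadratic cost `∫_I (‖C x‖² + ‖u‖²) ds`, with values in `[0, ∞]`. -/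
noncomputable def LQ.cost {n p m : ℕ} (C : Matrix (Fin m) (Fin n) ℝ) (I : Set ℝ)
    (u : ℝ → EuclideanSpace ℝ (Fin p)) (x : ℝ → EuclideanSpace ℝ (Fin n)) : ℝ≥0∞ :=
  ∫⁻ s in I, ENNReal.ofReal (‖matAct C (x s)‖ ^ 2 + ‖u s‖ ^ 2)

/-- The value function: the infimum, in `[0, ∞]`, of the cost on `I` over all controls
`u ∈ L²(I; ℝᵖ)` and the corresponding solutions `x` with `x(0) = ξ`. -/
noncomputable def LQ.value {n p m : ℕ} (A : Matrix (Fin n) (Fin n) ℝ)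
    (B : Matrix (Fin n) (Fin p) ℝ) (C : Matrix (Fin m) (Fin n) ℝ) (I : Set ℝ)
    (ξ : EuclideanSpace ℝ (Fin n)) : ℝ≥0∞ :=
  ⨅ (u : ℝ → EuclideanSpace ℝ (Fin p)) (x : ℝ → EuclideanSpace ℝ (Fin n))
    (_ : LQ.IsSolution A B I ξ u x), LQ.cost C I u x

/-- `(x, u)` is an optimal solution of the problem on `I` with initial state `ξ`. -/
structure LQ.IsOptimal {n p m : ℕ} (A : Matrix (Fin n) (Fin n) ℝ) (B : Matrix (Fin n) (Fin p) ℝ)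
    (C : Matrix (Fin m) (Fin n) ℝ) (I : Set ℝ) (ξ : EuclideanSpace ℝ (Fin n))
    (u : ℝ → EuclideanSpace ℝ (Fin p)) (x : ℝ → EuclideanSpace ℝ (Fin n)) : Prop where
  isSolution : LQ.IsSolution A B I ξ u x
  cost_eq : LQ.cost C I u x = LQ.value A B C I ξ

/-- `P` is a symmetric matrix, and the value function on `I` is finite and equal to the quadratic
form `⟨P ξ, ξ⟩`. -/
structure LQ.IsValueMatrix {n p m : ℕ} (A : Matrix (Fin n) (Fin n) ℝ)
    (B : Matrix (Fin n) (Fin p) ℝ) (C : Matrix (Fin m) (Fin n) ℝ) (I : Set ℝ)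
    (P : Matrix (Fin n) (Fin n) ℝ) : Prop where
  isSymm : P.IsSymm
  value_ne_top : ∀ ξ : EuclideanSpace ℝ (Fin n), LQ.value A B C I ξ ≠ ∞
  inner_eq : ∀ ξ : EuclideanSpace ℝ (Fin n),
    inner ℝ (matAct P ξ) ξ = (LQ.value A B C I ξ).toReal

/-- The finite cost condition for the triple `(A, B, C)`. -/
def LQ.FiniteCost {n p m : ℕ} (A : Matrix (Fin n) (Fin n) ℝ) (B : Matrix (Fin n) (Fin p) ℝ)
    (C : Matrix (Fin m) (Fin n) ℝ) : Prop :=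
  ∀ ξ : EuclideanSpace ℝ (Fin n), ∃ (u : ℝ → EuclideanSpace ℝ (Fin p))
    (x : ℝ → EuclideanSpace ℝ (Fin n)),
    LQ.IsSolution A B (Ici 0) ξ u x ∧ LQ.cost C (Ici 0) u x < ∞

/-!
The pairs `(u, C x)` of an `L²` control and the resulting `L²` output that start from `ξ` form a
closed affine subspace of `L²`, and the cost of `u` is the squared norm of the pair. Its element of
least norm depends linearly on `ξ`, so `V(ξ) = ‖F ξ‖²` for a linear map `F`, which is a quadratic
form, and the optimal control is unique.
The conditions on `[0, T]` become stronger as `T` grows and amount to the condition on `[0, ∞)`, so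
the least-norm elements, and with them the matrices `P_T`, converge.

The Riccati equation is obtained without assuming that optimal controls are continuous. Let `R` be
the left-hand side of the equation. By completion of squares, dynamic programming says that
`∫₀ʰ (⟨R x, x⟩ + ‖u + Bᵀ P x‖²)` is nonnegative along every solution and nonpositive along optimal
ones. Dividing by `h` and letting `h → 0`, the constant control `-Bᵀ P ξ` gives `⟨R ξ, ξ⟩ ≥ 0`,
because the square vanishes at time `0`, and the optimal control gives `⟨R ξ, ξ⟩ ≤ 0`. Hence
`R = 0`, and what remains of the integral along an optimal solution is the feedback law.
-/

section Leibniz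

variable {α β E F G : Type*} [MeasurableSpace α] [MeasurableSpace β]
  [NormedAddCommGroup E] [NormedSpace ℝ E] [NormedAddCommGroup F] [NormedSpace ℝ F]
  [NormedAddCommGroup G] [NormedSpace ℝ G] {μ : Measure α} {ν : Measure β} {f : α → E} {g : β → F}

theorem integrable_prod_bilin [SFinite ν] (L : E →L[ℝ] F →L[ℝ] G) (hf : Integrable f μ)
    (hg : Integrable g ν) : Integrable (fun z : α × β => L (f z.1) (g z.2)) (μ.prod ν) :=
  hf.op_fst_snd (op := fun a b => L a b) (by fun_prop) ⟨‖L‖, L.le_opNorm₂⟩ hg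

variable [CompleteSpace F] [CompleteSpace G]

theorem integral_indicator_bilin_slice (L : E →L[ℝ] F →L[ℝ] G) (hg : Integrable g ν)
    {D : Set (α × β)} (hD : MeasurableSet D) (s : α) :
    ∫ r, D.indicator (fun z => L (f z.1) (g z.2)) (s, r) ∂ν =
      L (f s) (∫ r in Prod.mk s ⁻¹' D, g r ∂ν) := by
  rw [← (L (f s)).integral_comp_comm hg.integrableOn,
    ← integral_indicator (measurable_prodMk_left hD)]
  rfl

theorem integrable_bilin_setIntegral_slice [SFinite ν] (L : E →L[ℝ] F →L[ℝ] G)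
    (hf : Integrable f μ) (hg : Integrable g ν) {D : Set (α × β)} (hD : MeasurableSet D) :
    Integrable (fun s => L (f s) (∫ r in Prod.mk s ⁻¹' D, g r ∂ν)) μ := by
  simpa only [integral_indicator_bilin_slice L hg hD] using
    ((integrable_prod_bilin L hf hg).indicator hD).integral_prod_left

theorem setIntegral_prod_bilin [SFinite μ] [SFinite ν] (L : E →L[ℝ] F →L[ℝ] G)
    (hf : Integrable f μ) (hg : Integrable g ν) {D : Set (α × β)} (hD : MeasurableSet D) :
    ∫ z in D, L (f z.1) (g z.2) ∂μ.prod ν =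
      ∫ s, L (f s) (∫ r in Prod.mk s ⁻¹' D, g r ∂ν) ∂μ := by
  rw [← integral_indicator hD, integral_prod _ ((integrable_prod_bilin L hf hg).indicator hD)]
  simp only [integral_indicator_bilin_slice L hg hD]

theorem bilin_integral_integral_eq_add [CompleteSpace E] [SFinite μ] [LinearOrder α]
    [TopologicalSpace α] [OrderClosedTopology α] [SecondCountableTopology α]
    [OpensMeasurableSpace α] (L : E →L[ℝ] F →L[ℝ] G) {g : α → F} (hf : Integrable f μ)
    (hg : Integrable g μ) :
    L (∫ s, f s ∂μ) (∫ s, g s ∂μ) =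
      (∫ s, L (f s) (∫ r in Iic s, g r ∂μ) ∂μ) + ∫ s, L (∫ r in Iio s, f r ∂μ) (g s) ∂μ := by
  let D : Set (α × α) := {z | z.2 ≤ z.1}
  have hD : MeasurableSet D := measurableSet_le measurable_snd measurable_fst
  have hswap : Prod.swap ⁻¹' Dᶜ = {z : α × α | z.2 < z.1} := ext fun _ => not_le
  have hcompl : ∫ z in Dᶜ, L (f z.1) (g z.2) ∂μ.prod μ =
      ∫ s, L (∫ r in Iio s, f r ∂μ) (g s) ∂μ := by
    rw [← Measure.measurePreserving_swap.setIntegral_preimage_emb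
      MeasurableEquiv.prodComm.measurableEmbedding, hswap]
    exact setIntegral_prod_bilin L.flip hg hf (measurableSet_lt measurable_snd measurable_fst)
  rw [← integral_prod_bilin L hf hg, ← integral_add_compl hD (integrable_prod_bilin L hf hg),
    setIntegral_prod_bilin L hf hg hD, hcompl]
  rfl

end Leibniz

section Primitive

variable {E F G : Type*} [NormedAddCommGroup E] [NormedSpace ℝ E] [NormedAddCommGroup F]
  [NormedSpace ℝ F] [NormedAddCommGroup G] [NormedSpace ℝ G]
  {f x : ℝ → E} {g y : ℝ → F} {x₀ : E} {y₀ : F} {a b : ℝ}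

theorem setIntegral_Iic_restrict_Ioc {s : ℝ} (hs : s ∈ Ioc a b) :
    ∫ r in Iic s, g r ∂volume.restrict (Ioc a b) = ∫ r in a..s, g r := by
  rw [Measure.restrict_restrict measurableSet_Iic, inter_comm, Ioc_inter_Iic, min_eq_right hs.2,
    intervalIntegral.integral_of_le hs.1.le]

theorem bilin_primitive_expand (L : E →L[ℝ] F →L[ℝ] G)
    (hx : ∀ s ∈ Icc a b, x s = x₀ + ∫ r in a..s, f r)
    (hy : ∀ s ∈ Icc a b, y s = y₀ + ∫ r in a..s, g r) {s : ℝ} (hs : s ∈ Ioc a b) :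
    L (f s) (y s) + L (x s) (g s) = (L.flip y₀ (f s) + L x₀ (g s)) +
      (L (f s) (∫ r in Iic s, g r ∂volume.restrict (Ioc a b)) +
        L (∫ r in Iio s, f r ∂volume.restrict (Ioc a b)) (g s)) := by
  rw [setIntegral_congr_set Iio_ae_eq_Iic, setIntegral_Iic_restrict_Ioc hs,
    setIntegral_Iic_restrict_Ioc hs, hx s (Ioc_subset_Icc_self hs), hy s (Ioc_subset_Icc_self hs)]
  simp only [map_add, add_apply, ContinuousLinearMap.flip_apply]
  abel

variable [CompleteSpace E] [CompleteSpace F] [CompleteSpace G]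

theorem intervalIntegrable_and_bilin_primitive_eq (L : E →L[ℝ] F →L[ℝ] G) (hab : a ≤ b)
    (hf : IntegrableOn f (Ioc a b)) (hg : IntegrableOn g (Ioc a b))
    (hx : ∀ s ∈ Icc a b, x s = x₀ + ∫ r in a..s, f r)
    (hy : ∀ s ∈ Icc a b, y s = y₀ + ∫ r in a..s, g r) :
    IntervalIntegrable (fun s => L (f s) (y s) + L (x s) (g s)) volume a b ∧
      L (x b) (y b) = L x₀ y₀ + ∫ s in a..b, (L (f s) (y s) + L (x s) (g s)) := by
  set μ := volume.restrict (Ioc a b)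
  have expand : EqOn _ _ (Ioc a b) := fun s hs => bilin_primitive_expand L hx hy hs
  have hconst₁ : Integrable (fun s => L.flip y₀ (f s)) μ := (L.flip y₀).integrable_comp hf
  have hconst₂ : Integrable (fun s => L x₀ (g s)) μ := (L x₀).integrable_comp hg
  have hconst : Integrable (fun s => L.flip y₀ (f s) + L x₀ (g s)) μ := hconst₁.add hconst₂
  have hprim₁ : Integrable (fun s => L (f s) (∫ r in Iic s, g r ∂μ)) μ :=
    integrable_bilin_setIntegral_slice L hf hg (measurableSet_le measurable_snd measurable_fst)
  have hprim₂ : Integrable (fun s => L (∫ r in Iio s, f r ∂μ) (g s)) μ :=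
    integrable_bilin_setIntegral_slice L.flip hg hf
      (measurableSet_lt measurable_snd measurable_fst)
  have hprim : Integrable (fun s => L (f s) (∫ r in Iic s, g r ∂μ) +
      L (∫ r in Iio s, f r ∂μ) (g s)) μ := hprim₁.add hprim₂
  refine ⟨(intervalIntegrable_iff_integrableOn_Ioc_of_le hab).2 <| IntegrableOn.congr_fun
    (hconst.add hprim) expand.symm measurableSet_Ioc, ?_⟩
  rw [intervalIntegral.integral_of_le hab, setIntegral_congr_fun measurableSet_Ioc expand,
    integral_add hconst hprim, integral_add hprim₁ hprim₂,
    integral_add hconst₁ hconst₂, ← bilin_integral_integral_eq_add L hf hg,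
    (L.flip y₀).integral_comp_comm hf, (L x₀).integral_comp_comm hg,
    hx b (right_mem_Icc.2 hab), hy b (right_mem_Icc.2 hab), intervalIntegral.integral_of_le hab,
    intervalIntegral.integral_of_le hab]
  simp only [map_add, add_apply, ContinuousLinearMap.flip_apply]
  abel

end Primitive

section OperatorPart

variable {E H : Type*} [AddCommGroup E] [Module ℝ E] [NormedAddCommGroup H]
  [InnerProductSpace ℝ H]

/-- `F` is the operator part of the linear relation `W`: it selects linearly, in each fibre
`{g | (ξ, g) ∈ W}`, the element orthogonal to the multivalued part `{g | (0, g) ∈ W}`, which is the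
element of least norm. -/
structure IsOperatorPart (W : Submodule ℝ (E × H)) (F : E →ₗ[ℝ] H) : Prop where
  mem : ∀ ξ, (ξ, F ξ) ∈ W
  inner_eq_zero : ∀ ξ g, ((0 : E), g) ∈ W → inner ℝ (F ξ) g = 0

theorem exists_isOperatorPart [CompleteSpace H] (W : Submodule ℝ (E × H))
    (hcl : IsClosed {g : H | ((0 : E), g) ∈ W}) (hne : ∀ ξ, ∃ g, (ξ, g) ∈ W) :
    ∃ F : E →ₗ[ℝ] H, IsOperatorPart W F := by
  let K : Submodule ℝ H := W.comap (LinearMap.inr ℝ E H)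
  have : CompleteSpace K := IsClosed.completeSpace_coe (hs := hcl)
  let π : W →ₗ[ℝ] E := LinearMap.fst ℝ E H ∘ₗ W.subtype
  have hπ : LinearMap.range π = ⊤ := LinearMap.range_eq_top.2 fun ξ =>
    let ⟨g, hg⟩ := hne ξ
    ⟨⟨(ξ, g), hg⟩, rfl⟩
  obtain ⟨σ, hσ⟩ := π.exists_rightInverse_of_surjective hπ
  let G : E →ₗ[ℝ] H := LinearMap.snd ℝ E H ∘ₗ W.subtype ∘ₗ σ
  have hG : ∀ ξ, (ξ, G ξ) ∈ W := fun ξ => by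
    have hσξ : (σ ξ : E × H) = (ξ, G ξ) := Prod.ext (LinearMap.congr_fun hσ ξ) rfl
    exact hσξ ▸ (σ ξ).2
  refine ⟨G - K.starProjection.toLinearMap ∘ₗ G, fun ξ => ?_, fun ξ g hg => ?_⟩
  · have hproj : ((0 : E), K.starProjection (G ξ)) ∈ W := K.starProjection_apply_mem (G ξ)
    simpa using W.sub_mem (hG ξ) hproj
  · rw [real_inner_comm]
    exact Submodule.sub_starProjection_mem_orthogonal (G ξ) _ hg

namespace IsOperatorPart

variable {W : Submodule ℝ (E × H)} {F : E →ₗ[ℝ] H} {ξ : E} {g : H}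

theorem norm_sq_eq (hF : IsOperatorPart W F) (hg : (ξ, g) ∈ W) :
    ‖g‖ ^ 2 = ‖F ξ‖ ^ 2 + ‖g - F ξ‖ ^ 2 := by
  have hsub : ((0 : E), g - F ξ) ∈ W := by simpa using W.sub_mem hg (hF.mem ξ)
  simpa [hF.inner_eq_zero ξ _ hsub] using norm_add_sq_real (F ξ) (g - F ξ)

theorem norm_sq_le (hF : IsOperatorPart W F) (hg : (ξ, g) ∈ W) : ‖F ξ‖ ^ 2 ≤ ‖g‖ ^ 2 := by
  rw [hF.norm_sq_eq hg]
  exact le_add_of_nonneg_right (sq_nonneg _)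

theorem eq_of_norm_sq_le (hF : IsOperatorPart W F) (hg : (ξ, g) ∈ W)
    (h : ‖g‖ ^ 2 ≤ ‖F ξ‖ ^ 2) : g = F ξ := by
  rw [hF.norm_sq_eq hg, add_le_iff_nonpos_right] at h
  exact sub_eq_zero.1 (norm_eq_zero.1 (pow_eq_zero_iff two_ne_zero |>.1 (h.antisymm (sq_nonneg _))))

variable {ι : Type*} [SemilatticeSup ι] [Nonempty ι] {V : ι → Submodule ℝ (E × H)}
  {G : ι → E →ₗ[ℝ] H}

theorem cauchySeq (hV : Antitone V) (hG : ∀ i, IsOperatorPart (V i) (G i))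
    (hbdd : BddAbove (range fun i => ‖G i ξ‖ ^ 2)) : CauchySeq fun i => G i ξ := by
  have hmem : ∀ {i j}, i ≤ j → (ξ, G j ξ) ∈ V i := fun hij => hV hij ((hG _).mem ξ)
  have hmono : Monotone fun i => ‖G i ξ‖ ^ 2 := fun i j hij => (hG i).norm_sq_le (hmem hij)
  refine Metric.cauchySeq_iff'.2 fun ε hε => ?_
  obtain ⟨N, hN⟩ := Metric.cauchySeq_iff'.1 (tendsto_atTop_ciSup hmono hbdd).cauchySeq (ε ^ 2)
    (by positivity)
  refine ⟨N, fun i hi => lt_of_pow_lt_pow_left₀ 2 hε.le ?_⟩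
  calc dist (G i ξ) (G N ξ) ^ 2 = ‖G i ξ‖ ^ 2 - ‖G N ξ‖ ^ 2 := by
        rw [dist_eq_norm, (hG N).norm_sq_eq (hmem hi), add_sub_cancel_left]
    _ ≤ dist (‖G i ξ‖ ^ 2) (‖G N ξ‖ ^ 2) := le_abs_self _
    _ < ε ^ 2 := hN i hi

theorem tendsto_iInf [CompleteSpace H] (hV : Antitone V)
    (hcl : ∀ i, IsClosed {g : H | ((0 : E), g) ∈ V i})
    (hG : ∀ i, IsOperatorPart (V i) (G i)) (hF : IsOperatorPart (⨅ i, V i) F) (ξ : E) :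
    Tendsto (fun i => G i ξ) atTop (𝓝 (F ξ)) := by
  have hFmem : ∀ i, (ξ, F ξ) ∈ V i := fun i => iInf_le V i (hF.mem ξ)
  have hle : ∀ i, ‖G i ξ‖ ^ 2 ≤ ‖F ξ‖ ^ 2 := fun i => (hG i).norm_sq_le (hFmem i)
  obtain ⟨g, hg⟩ := cauchySeq_tendsto_of_complete
    (cauchySeq hV hG (ξ := ξ) ⟨_, forall_mem_range.2 hle⟩)
  have hgmem : ∀ i, (ξ, g) ∈ V i := fun i => by
    have hdiff : ((0 : E), g - F ξ) ∈ V i := by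
      refine (hcl i).mem_of_tendsto (hg.sub_const (F ξ)) ?_
      filter_upwards [eventually_ge_atTop i] with j hij
      simpa using (V i).sub_mem (hV hij ((hG j).mem ξ)) (hFmem i)
    simpa using (V i).add_mem hdiff (hFmem i)
  rwa [← hF.eq_of_norm_sq_le (Submodule.mem_iInf V |>.2 hgmem)
    (le_of_tendsto' (hg.norm.pow 2) hle)]

end IsOperatorPart

end OperatorPart

section MildSolution

variable {E : Type*} [NormedAddCommGroup E] [NormedSpace ℝ E]

/-- The mild solution of `x' = A x + b`, `x 0 = ξ`, given by variation of constants. -/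
noncomputable def mildSolution (A : E →L[ℝ] E) (ξ : E) (b : ℝ → E) (t : ℝ) : E :=
  NormedSpace.exp (t • A) (ξ + ∫ s in (0 : ℝ)..t, NormedSpace.exp ((-s) • A) (b s))

theorem mildSolution_congr (A : E →L[ℝ] E) (ξ : E) {b b' : ℝ → E} {t : ℝ} (ht : 0 ≤ t)
    (h : b =ᵐ[volume.restrict (Ioc 0 t)] b') : mildSolution A ξ b t = mildSolution A ξ b' t := by
  simp only [mildSolution, intervalIntegral.integral_of_le ht]
  congr 2
  exact integral_congr_ae (h.mono fun s hs => congrArg _ hs)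

variable [CompleteSpace E]

@[fun_prop]
theorem continuous_exp_smul (A : E →L[ℝ] E) : Continuous fun t : ℝ => NormedSpace.exp (t • A) :=
  (differentiable_exp_smul_const ℝ A).continuous

@[fun_prop]
theorem continuous_exp_neg_smul (A : E →L[ℝ] E) :
    Continuous fun t : ℝ => NormedSpace.exp ((-t) • A) :=
  (continuous_exp_smul A).comp continuous_neg

theorem hasDerivAt_exp_neg_smul (A : E →L[ℝ] E) (t : ℝ) :
    HasDerivAt (fun s : ℝ => NormedSpace.exp ((-s) • A)) (-(NormedSpace.exp ((-t) • A) * A)) t := by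
  simpa [Function.comp_def] using
    (hasDerivAt_exp_smul_const (𝕂 := ℝ) A (-t)).scomp t (hasDerivAt_neg t)

theorem exp_smul_mul_exp_neg_smul (A : E →L[ℝ] E) (t : ℝ) :
    NormedSpace.exp (t • A) * NormedSpace.exp ((-t) • A) = 1 := by
  let := NormedAlgebra.restrictScalars ℚ ℝ (E →L[ℝ] E)
  rw [← NormedSpace.exp_add_of_commute (((Commute.refl A).smul_left t).smul_right (-t)),
    ← add_smul, add_neg_cancel, zero_smul, NormedSpace.exp_zero]

theorem exp_smul_exp_neg_smul (A : E →L[ℝ] E) (t : ℝ) (v : E) :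
    NormedSpace.exp (t • A) (NormedSpace.exp ((-t) • A) v) = v :=
  DFunLike.congr_fun (exp_smul_mul_exp_neg_smul A t) v

theorem integrableOn_exp_neg_smul (A : E →L[ℝ] E) {b : ℝ → E} {t : ℝ}
    (hb : IntegrableOn b (Ioc 0 t)) :
    IntegrableOn (fun s => NormedSpace.exp ((-s) • A) (b s)) (Ioc 0 t) := by
  have hc := continuous_exp_neg_smul A
  obtain ⟨K, hK⟩ := isCompact_Icc.exists_bound_of_continuousOn (s := Icc 0 t) hc.continuousOn
  refine Integrable.mono' (hb.norm.const_mul K) ?_ ?_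
  · exact (ContinuousLinearMap.id ℝ (E →L[ℝ] E)).aestronglyMeasurable_comp₂
      hc.aestronglyMeasurable hb.1
  · filter_upwards [ae_restrict_mem measurableSet_Ioc] with s hs
    exact (NormedSpace.exp ((-s) • A)).le_of_opNorm_le (hK s (Ioc_subset_Icc_self hs)) _

theorem eq_mildSolution (A : E →L[ℝ] E) {ξ : E} {b x : ℝ → E} {t : ℝ} (ht : 0 ≤ t)
    (hb : IntegrableOn b (Ioc 0 t)) (hxc : ContinuousOn x (Icc 0 t))
    (hx : ∀ s ∈ Icc 0 t, x s = ξ + ∫ r in (0 : ℝ)..s, (A (x r) + b r)) :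
    x t = mildSolution A ξ b t := by
  have hc : Continuous fun s : ℝ => -(NormedSpace.exp ((-s) • A) * A) := by fun_prop
  have hexp : ∀ s ∈ Icc 0 t, NormedSpace.exp ((-s) • A) =
      1 + ∫ r in (0 : ℝ)..s, -(NormedSpace.exp ((-r) • A) * A) := fun s _ => by
    rw [intervalIntegral.integral_eq_sub_of_hasDerivAt
      (fun r _ => hasDerivAt_exp_neg_smul A r) (hc.intervalIntegrable _ _)]
    simp
  have hAx : IntegrableOn (fun s => A (x s)) (Ioc 0 t) :=
    (A.continuous.comp_continuousOn hxc).integrableOn_Icc.mono_set Ioc_subset_Icc_self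
  have hdetrended : NormedSpace.exp ((-t) • A) (x t) =
      ξ + ∫ s in (0 : ℝ)..t, NormedSpace.exp ((-s) • A) (b s) := by
    simpa using (intervalIntegrable_and_bilin_primitive_eq (ContinuousLinearMap.id ℝ (E →L[ℝ] E))
      ht (hc.integrableOn_Icc.mono_set Ioc_subset_Icc_self) (hAx.add hb) hexp hx).2
  rw [mildSolution, ← hdetrended, exp_smul_exp_neg_smul]

theorem continuousOn_mildSolution (A : E →L[ℝ] E) (ξ : E) {b : ℝ → E} {t : ℝ}
    (hb : IntegrableOn b (Ioc 0 t)) : ContinuousOn (mildSolution A ξ b) (Icc 0 t) := by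
  rcases lt_or_ge t 0 with ht | ht
  · simp [Icc_eq_empty_of_lt ht]
  have hint : IntegrableOn (fun s => NormedSpace.exp ((-s) • A) (b s)) (uIcc 0 t) := by
    rw [uIcc_of_le ht, integrableOn_Icc_iff_integrableOn_Ioc]
    exact integrableOn_exp_neg_smul A hb
  have hprim := intervalIntegral.continuousOn_primitive_interval hint
  rw [uIcc_of_le ht] at hprim
  exact (continuous_exp_smul A).continuousOn.clm_apply (continuousOn_const.add hprim)

theorem mildSolution_eq_add_integral (A : E →L[ℝ] E) (ξ : E) {b : ℝ → E} {t : ℝ} (ht : 0 ≤ t)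
    (hb : IntegrableOn b (Ioc 0 t)) :
    mildSolution A ξ b t = ξ + ∫ s in (0 : ℝ)..t, (A (mildSolution A ξ b s) + b s) := by
  have hc : Continuous fun s : ℝ => A * NormedSpace.exp (s • A) := by fun_prop
  have hexp : ∀ s ∈ Icc 0 t, NormedSpace.exp (s • A) =
      1 + ∫ r in (0 : ℝ)..s, A * NormedSpace.exp (r • A) := fun s _ => by
    rw [intervalIntegral.integral_eq_sub_of_hasDerivAt
      (fun r _ => hasDerivAt_exp_smul_const' (𝕂 := ℝ) A r) (hc.intervalIntegrable _ _)]
    simp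
  have hprod := (intervalIntegrable_and_bilin_primitive_eq (ContinuousLinearMap.id ℝ (E →L[ℝ] E))
    ht (hc.integrableOn_Icc.mono_set Ioc_subset_Icc_self) (integrableOn_exp_neg_smul A hb) hexp
    (fun s _ => rfl) (y₀ := ξ)).2
  simpa [mildSolution, exp_smul_exp_neg_smul, -neg_smul] using hprod

end MildSolution

/-- The space of square integrable functions on the half-line `[0, ∞)`. -/
abbrev HalfLineL2 (F : Type*) [NormedAddCommGroup F] : Type _ :=
  Lp F 2 (volume.restrict (Ici (0 : ℝ)))

/-- The Hilbert space of pairs (control, output) of square integrable functions on `[0, ∞)`. -/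
abbrev Signal (U Y : Type*) [NormedAddCommGroup U] [NormedAddCommGroup Y] : Type _ :=
  WithLp 2 (HalfLineL2 U × HalfLineL2 Y)

theorem memLp_indicator_Ioc_of_continuous {F : Type*} [NormedAddCommGroup F] {f : ℝ → F}
    (hf : Continuous f) (p : ℝ≥0∞) (a b : ℝ) {μ : Measure ℝ} [IsLocallyFiniteMeasure μ] :
    MemLp ((Ioc a b).indicator f) p μ := by
  obtain ⟨K, hK⟩ := isCompact_Icc.exists_bound_of_continuousOn (s := Icc a b) hf.continuousOn
  have : IsFiniteMeasure (μ.restrict (Ioc a b)) := isFiniteMeasure_restrict.2 measure_Ioc_lt_top.ne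
  refine (memLp_indicator_iff_restrict measurableSet_Ioc).2
    (MemLp.of_bound hf.aestronglyMeasurable K ?_)
  filter_upwards [ae_restrict_mem measurableSet_Ioc] with s hs
  exact hK s (Ioc_subset_Icc_self hs)

section OutputRelation

variable {E U Y : Type*} [NormedAddCommGroup E] [NormedSpace ℝ E] [CompleteSpace E]
  [NormedAddCommGroup U] [NormedSpace ℝ U] [NormedAddCommGroup Y] [NormedSpace ℝ Y]

theorem memLp_indicator_exp_neg_smul_comp (A : E →L[ℝ] E) (B : U →L[ℝ] E) (t : ℝ) :
    MemLp ((Ioc 0 t).indicator fun s : ℝ => NormedSpace.exp ((-s) • A) ∘L B) 2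
      (volume.restrict (Ici (0 : ℝ))) :=
  memLp_indicator_Ioc_of_continuous (by fun_prop) 2 0 t

/-- The state at time `t` of the system `x' = A x + B u`, `x 0 = ξ`, as a continuous linear function
of the pair `(ξ, u)`. For `t < 0` the value is the free evolution of `ξ`. -/
noncomputable def stateCLM (A : E →L[ℝ] E) (B : U →L[ℝ] E) (t : ℝ) :
    E × HalfLineL2 U →L[ℝ] E :=
  NormedSpace.exp (t • A) ∘L (ContinuousLinearMap.fst ℝ E (HalfLineL2 U) +
    (ContinuousLinearMap.id ℝ (U →L[ℝ] E)).lpPairing (volume.restrict (Ici 0)) 2 2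
      (memLp_indicator_exp_neg_smul_comp A B t).toLp ∘L
        ContinuousLinearMap.snd ℝ E (HalfLineL2 U))

theorem stateCLM_apply (A : E →L[ℝ] E) (B : U →L[ℝ] E) {t : ℝ} (ht : 0 ≤ t) (ξ : E)
    (v : HalfLineL2 U) : stateCLM A B t (ξ, v) = mildSolution A ξ (fun s => B (v s)) t := by
  have hint : (ContinuousLinearMap.id ℝ (U →L[ℝ] E)).lpPairing (volume.restrict (Ici 0)) 2 2
      (memLp_indicator_exp_neg_smul_comp A B t).toLp v =
        ∫ s in (0 : ℝ)..t, NormedSpace.exp ((-s) • A) (B (v s)) := by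
    have hae : ∀ᵐ s ∂volume.restrict (Ici (0 : ℝ)),
        (memLp_indicator_exp_neg_smul_comp A B t).toLp _ s (v s) =
          (Ioc 0 t).indicator (fun s => NormedSpace.exp ((-s) • A) (B (v s))) s := by
      filter_upwards [(memLp_indicator_exp_neg_smul_comp A B t).coeFn_toLp] with s hs
      rw [hs]
      by_cases hst : s ∈ Ioc 0 t <;> simp [hst]
    rw [ContinuousLinearMap.lpPairing_eq_integral]
    refine (integral_congr_ae hae).trans ?_
    rw [setIntegral_indicator measurableSet_Ioc, intervalIntegral.integral_of_le ht,
      inter_eq_right.2 (Ioc_subset_Ioi_self.trans Ioi_subset_Ici_self)]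
  simp only [stateCLM, mildSolution, ContinuousLinearMap.comp_apply, add_apply,
    ContinuousLinearMap.coe_fst', ContinuousLinearMap.coe_snd', hint]

/-- The linear relation between an initial state `ξ` and a signal `(u, y)` which says that `y` is on
the time interval `I` the output `C x` of the solution of `x' = A x + B u`, `x 0 = ξ`. -/
noncomputable def outputRelation (A : E →L[ℝ] E) (B : U →L[ℝ] E) (C : E →L[ℝ] Y) (I : Set ℝ) :
    Submodule ℝ (E × Signal U Y) where
  carrier := {z | ∀ᵐ s ∂volume.restrict (Ici (0 : ℝ)), s ∈ I →
    z.2.snd s = C (stateCLM A B s (z.1, z.2.fst))}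
  add_mem' {z w} hz hw := by
    filter_upwards [hz, hw, Lp.coeFn_add z.2.snd w.2.snd] with s hzs hws hadd hs
    have hpair : ((z + w).1, (z + w).2.fst) = (z.1, z.2.fst) + (w.1, w.2.fst) := rfl
    rw [hpair, map_add, map_add, ← hzs hs, ← hws hs]
    exact hadd
  zero_mem' := by
    filter_upwards [Lp.coeFn_zero Y 2 (volume.restrict (Ici (0 : ℝ)))] with s hzero _
    have hpair : ((0 : E × Signal U Y).1, (0 : E × Signal U Y).2.fst) = 0 := rfl
    rw [hpair, map_zero, map_zero]
    exact hzero
  smul_mem' c z hz := by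
    filter_upwards [hz, Lp.coeFn_smul c z.2.snd] with s hzs hsmul hs
    have hpair : ((c • z).1, (c • z).2.fst) = c • (z.1, z.2.fst) := rfl
    rw [hpair, map_smul, map_smul, ← hzs hs]
    exact hsmul

variable {A : E →L[ℝ] E} {B : U →L[ℝ] E} {C : E →L[ℝ] Y} {I J : Set ℝ}

theorem mem_outputRelation {z : E × Signal U Y} : z ∈ outputRelation A B C I ↔
    ∀ᵐ s ∂volume.restrict (Ici (0 : ℝ)), s ∈ I →
      z.2.snd s = C (stateCLM A B s (z.1, z.2.fst)) :=
  Iff.rfl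

theorem mem_outputRelation_iff {ξ : E} {g : Signal U Y} : (ξ, g) ∈ outputRelation A B C I ↔
    ∀ᵐ s ∂volume.restrict (Ici (0 : ℝ)), s ∈ I →
      g.snd s = C (mildSolution A ξ (fun r => B (g.fst r)) s) := by
  refine mem_outputRelation.trans (eventually_congr ?_)
  filter_upwards [ae_restrict_mem measurableSet_Ici] with s hs
  rw [stateCLM_apply A B hs]

theorem isClosed_outputRelation (A : E →L[ℝ] E) (B : U →L[ℝ] E) (C : E →L[ℝ] Y) (I : Set ℝ) :
    IsClosed (outputRelation A B C I : Set (E × Signal U Y)) := by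
  refine IsSeqClosed.isClosed fun z w hz hzw => ?_
  have hfst : Tendsto (fun k => ((z k).1, (z k).2.fst)) atTop (𝓝 (w.1, w.2.fst)) :=
    hzw.fst_nhds.prodMk_nhds (((WithLp.fstL 2 ℝ _ _).continuous.tendsto _).comp hzw.snd_nhds)
  have hsnd : Tendsto (fun k => (z k).2.snd) atTop (𝓝 w.2.snd) :=
    ((WithLp.sndL 2 ℝ _ _).continuous.tendsto _).comp hzw.snd_nhds
  obtain ⟨φ, hφ, hae⟩ := (tendstoInMeasure_of_tendsto_Lp hsnd).exists_seq_tendsto_ae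
  filter_upwards [hae, ae_all_iff.2 hz] with s hlim hzs hs
  have hstate := ((C ∘L stateCLM A B s).continuous.tendsto _).comp (hfst.comp hφ.tendsto_atTop)
  exact tendsto_nhds_unique hlim (hstate.congr fun k => (hzs (φ k) hs).symm)

theorem isClosed_setOf_zero_mem_outputRelation (A : E →L[ℝ] E) (B : U →L[ℝ] E) (C : E →L[ℝ] Y)
    (I : Set ℝ) : IsClosed {g | ((0 : E), g) ∈ outputRelation A B C I} :=
  (isClosed_outputRelation A B C I).preimage (.prodMk_right 0)

theorem outputRelation_anti (h : I ⊆ J) : outputRelation A B C J ≤ outputRelation A B C I :=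
  fun _ hz => (mem_outputRelation.1 hz).mono fun _ hs hsI => hs (h hsI)

theorem outputRelation_Ici_eq_iInf (A : E →L[ℝ] E) (B : U →L[ℝ] E) (C : E →L[ℝ] Y) :
    outputRelation A B C (Ici 0) = ⨅ T : ℝ, outputRelation A B C (Icc 0 T) := by
  refine le_antisymm (le_iInf fun T => outputRelation_anti Icc_subset_Ici_self) fun z hz => ?_
  filter_upwards [ae_all_iff.2 fun k : ℕ => (Submodule.mem_iInf _).1 hz k] with s hs hs0
  obtain ⟨k, hk⟩ := exists_nat_ge s
  exact hs k ⟨hs0, hk⟩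

end OutputRelation

theorem ofReal_norm_sq_eq_enorm_sq {F : Type*} [SeminormedAddCommGroup F] (a : F) :
    ENNReal.ofReal (‖a‖ ^ 2) = ‖a‖ₑ ^ 2 := by
  rw [ENNReal.ofReal_pow (norm_nonneg a), ofReal_norm]

theorem eLpNorm_two_sq_eq_lintegral {α F : Type*} [MeasurableSpace α] [NormedAddCommGroup F]
    (f : α → F) (μ : Measure α) : eLpNorm f 2 μ ^ 2 = ∫⁻ s, ‖f s‖ₑ ^ 2 ∂μ := by
  simpa using eLpNorm_nnreal_pow_eq_lintegral (f := f) (μ := μ) (p := 2) two_ne_zero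

theorem exists_Lp_zero_extension {α F : Type*} [MeasurableSpace α] [NormedAddCommGroup F]
    {μ : Measure α} {I J : Set α} (hI : MeasurableSet I) (hIJ : I ⊆ J) {p : ℝ≥0∞} {f : α → F}
    (hf : MemLp f p (μ.restrict I)) : ∃ g : Lp F p (μ.restrict J), g =ᵐ[μ.restrict I] f ∧
      eLpNorm g p (μ.restrict J) = eLpNorm f p (μ.restrict I) := by
  have hrestrict : (μ.restrict J).restrict I = μ.restrict I := by
    rw [Measure.restrict_restrict hI, inter_eq_left.2 hIJ]
  have hmem : MemLp (I.indicator f) p (μ.restrict J) := by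
    rwa [memLp_indicator_iff_restrict hI, hrestrict]
  refine ⟨hmem.toLp _, ?_, ?_⟩
  · exact EventuallyEq.trans (ae_restrict_of_ae_restrict_of_subset hIJ hmem.coeFn_toLp)
      (indicator_ae_eq_restrict hI)
  · rw [eLpNorm_congr_ae hmem.coeFn_toLp, eLpNorm_indicator_eq_eLpNorm_restrict hI, hrestrict]

theorem ofReal_norm_sq_signal {U Y : Type*} [NormedAddCommGroup U] [NormedAddCommGroup Y]
    (g : Signal U Y) : ENNReal.ofReal (‖g‖ ^ 2) =
      eLpNorm g.fst 2 (volume.restrict (Ici (0 : ℝ))) ^ 2 +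
        eLpNorm g.snd 2 (volume.restrict (Ici (0 : ℝ))) ^ 2 := by
  rw [WithLp.prod_norm_sq_eq_of_L2, ENNReal.ofReal_add (sq_nonneg _) (sq_nonneg _),
    ofReal_norm_sq_eq_enorm_sq, ofReal_norm_sq_eq_enorm_sq, Lp.enorm_def, Lp.enorm_def]

section Matrices

variable {k l : ℕ}

/-- The continuous linear map between Euclidean spaces defined by a matrix, that is, `matAct M` as a
bundled map. -/
noncomputable def matCLM (M : Matrix (Fin k) (Fin l) ℝ) :
    EuclideanSpace ℝ (Fin l) →L[ℝ] EuclideanSpace ℝ (Fin k) :=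
  LinearMap.toContinuousLinearMap (Matrix.toLpLin 2 2 M)

theorem matCLM_apply (M : Matrix (Fin k) (Fin l) ℝ) (x : EuclideanSpace ℝ (Fin l)) :
    matCLM M x = matAct M x :=
  rfl

@[fun_prop]
theorem continuous_matAct (M : Matrix (Fin k) (Fin l) ℝ) : Continuous (matAct M) :=
  (matCLM M).continuous

theorem matAct_mul {j : ℕ} (M : Matrix (Fin k) (Fin l) ℝ) (N : Matrix (Fin l) (Fin j) ℝ)
    (x : EuclideanSpace ℝ (Fin j)) : matAct (M * N) x = matAct M (matAct N x) := by
  simp [matAct, Matrix.mulVec_mulVec]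

theorem matAct_add (M N : Matrix (Fin k) (Fin l) ℝ) (x : EuclideanSpace ℝ (Fin l)) :
    matAct (M + N) x = matAct M x + matAct N x := by
  simp [matAct, Matrix.add_mulVec]

theorem matAct_sub (M N : Matrix (Fin k) (Fin l) ℝ) (x : EuclideanSpace ℝ (Fin l)) :
    matAct (M - N) x = matAct M x - matAct N x := by
  simp [matAct, Matrix.sub_mulVec]

theorem inner_matAct_left (M : Matrix (Fin k) (Fin l) ℝ) (x : EuclideanSpace ℝ (Fin l))
    (y : EuclideanSpace ℝ (Fin k)) : inner ℝ (matAct M x) y = inner ℝ x (matAct Mᵀ y) := by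
  simp only [matAct, EuclideanSpace.inner_eq_star_dotProduct, star_trivial,
    Matrix.dotProduct_mulVec, Matrix.mulVec_transpose]

theorem eq_zero_of_isSymm_of_inner_matAct_self {M : Matrix (Fin k) (Fin k) ℝ} (hM : M.IsSymm)
    (h : ∀ ξ, inner ℝ (matAct M ξ) ξ = (0 : ℝ)) : M = 0 := by
  have hs : (Matrix.toLpLin 2 2 M : EuclideanSpace ℝ (Fin k) →ₗ[ℝ] _).IsSymmetric := fun x y => by
    have hxy := inner_matAct_left M x y
    rwa [hM.eq] at hxy
  exact (Matrix.toLpLin 2 2).map_eq_zero_iff.1 (hs.inner_map_self_eq_zero.1 h)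

variable {H : Type*} [NormedAddCommGroup H] [InnerProductSpace ℝ H]
  (F : EuclideanSpace ℝ (Fin k) →ₗ[ℝ] H)

/-- The symmetric matrix of the quadratic form `ξ ↦ ‖F ξ‖ ^ 2` in the standard basis. -/
noncomputable def gramMatrix : Matrix (Fin k) (Fin k) ℝ :=
  Matrix.gram ℝ fun i => F (EuclideanSpace.single i 1)

theorem isSymm_gramMatrix : (gramMatrix F).IsSymm :=
  Matrix.isHermitian_gram ℝ _

theorem inner_matAct_gramMatrix_self (ξ : EuclideanSpace ℝ (Fin k)) :
    inner ℝ (matAct (gramMatrix F) ξ) ξ = ‖F ξ‖ ^ 2 := by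
  have hF : ∑ i, ξ i • F (EuclideanSpace.single i 1) = F ξ := by
    simpa only [map_sum, map_smul, EuclideanSpace.basisFun_repr,
      EuclideanSpace.basisFun_apply] using
      congrArg F ((EuclideanSpace.basisFun (Fin k) ℝ).sum_repr ξ)
  rw [← real_inner_self_eq_norm_sq, ← hF, ← Matrix.star_dotProduct_gram_mulVec,
    EuclideanSpace.inner_eq_star_dotProduct]
  rfl

theorem tendsto_gramMatrix {ι : Type*} {f : Filter ι} {F} {G : ι → EuclideanSpace ℝ (Fin k) →ₗ[ℝ] H}
    (h : ∀ ξ, Tendsto (fun i => G i ξ) f (𝓝 (F ξ))) :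
    Tendsto (fun i => gramMatrix (G i)) f (𝓝 (gramMatrix F)) :=
  tendsto_pi_nhds.2 fun _ => tendsto_pi_nhds.2 fun _ => (h _).inner (h _)

end Matrices

namespace LQ

variable {n p m : ℕ} {A : Matrix (Fin n) (Fin n) ℝ} {B : Matrix (Fin n) (Fin p) ℝ}
  {C : Matrix (Fin m) (Fin n) ℝ} {I J : Set ℝ} {ξ : EuclideanSpace ℝ (Fin n)}
  {u u' : ℝ → EuclideanSpace ℝ (Fin p)} {x x' : ℝ → EuclideanSpace ℝ (Fin n)}

theorem integrableOn_Ioc_of_memLp_two {F : Type*} [NormedAddCommGroup F] {f : ℝ → F} {a b : ℝ}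
    (hI : Ioc a b ⊆ I) (hf : MemLp f 2 (volume.restrict I)) : IntegrableOn f (Ioc a b) :=
  (hf.mono_measure (Measure.restrict_mono hI le_rfl)).integrable one_le_two

theorem IsSolution.mono (h : IsSolution A B I ξ u x) (hJ : J ⊆ I) : IsSolution A B J ξ u x :=
  ⟨h.memLp.mono_measure (Measure.restrict_mono hJ le_rfl), h.continuousOn.mono hJ,
    fun t ht => h.eq_integral t (hJ ht)⟩

theorem IsSolution.eqOn_mildSolution (h : IsSolution A B I ξ u x) (hI : I.OrdConnected)
    (h0 : IsLeast I 0) : EqOn x (mildSolution (matCLM A) ξ fun s => matCLM B (u s)) I := by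
  intro t ht
  have hsub : Icc 0 t ⊆ I := hI.out h0.1 ht
  exact eq_mildSolution (matCLM A) (h0.2 ht) ((matCLM B).integrable_comp
    (integrableOn_Ioc_of_memLp_two (Ioc_subset_Icc_self.trans hsub) h.memLp))
    (h.continuousOn.mono hsub) fun s hs => h.eq_integral s (hsub hs)

theorem IsSolution.eqOn_of_ae_eq (h : IsSolution A B I ξ u x) (h' : IsSolution A B I ξ u' x')
    (hI : I.OrdConnected) (h0 : IsLeast I 0) (hu : u =ᵐ[volume.restrict I] u') : EqOn x x' I := by
  intro t ht
  have hsub : Ioc 0 t ⊆ I := Ioc_subset_Icc_self.trans (hI.out h0.1 ht)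
  rw [h.eqOn_mildSolution hI h0 ht, h'.eqOn_mildSolution hI h0 ht]
  refine mildSolution_congr _ _ (h0.2 ht) ?_
  exact (ae_restrict_of_ae_restrict_of_subset hsub hu).mono fun s hs => congrArg (matCLM B) hs

theorem isSolution_mildSolution (hu : MemLp u 2 (volume.restrict (Ici 0))) :
    IsSolution A B (Ici 0) ξ u (mildSolution (matCLM A) ξ fun s => matCLM B (u s)) := by
  have hb : ∀ t, IntegrableOn (fun s => matCLM B (u s)) (Ioc 0 t) := fun t =>
    (matCLM B).integrable_comp (integrableOn_Ioc_of_memLp_two (fun _ hs => hs.1.le) hu)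
  refine ⟨hu, fun t ht => ?_, fun t ht => mildSolution_eq_add_integral _ ξ ht (hb t)⟩
  refine (continuousOn_mildSolution (matCLM A) ξ (hb (t + 1)) t
    ⟨ht, (lt_add_one t).le⟩).mono_of_mem_nhdsWithin ?_
  exact inter_mem_nhdsWithin (Ici 0) (Iic_mem_nhds (lt_add_one t))

theorem value_le_cost (hs : IsSolution A B I ξ u x) : value A B C I ξ ≤ cost C I u x :=
  iInf_le_of_le _ (iInf_le_of_le _ (iInf_le _ hs))

theorem le_value {c : ℝ≥0∞} (h : ∀ u x, IsSolution A B I ξ u x → c ≤ cost C I u x) :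
    c ≤ value A B C I ξ :=
  le_iInf fun u => le_iInf fun x => le_iInf fun hs => h u x hs

theorem cost_eq_eLpNorm_sq_add (hu : AEStronglyMeasurable u (volume.restrict I)) :
    cost C I u x = eLpNorm u 2 (volume.restrict I) ^ 2 +
      eLpNorm (fun s => matAct C (x s)) 2 (volume.restrict I) ^ 2 := by
  simp only [eLpNorm_two_sq_eq_lintegral]
  rw [← lintegral_add_left' (hu.enorm.pow_const 2), cost]
  refine lintegral_congr fun s => ?_
  rw [add_comm, ENNReal.ofReal_add (sq_nonneg _) (sq_nonneg _), ofReal_norm_sq_eq_enorm_sq,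
    ofReal_norm_sq_eq_enorm_sq]

/-- The linear relation between the initial states of the control system `x' = A x + B u` and the
pairs `(u, y)` such that `y` is the output `C x` on the time interval `I`. -/
noncomputable abbrev signalRelation (A : Matrix (Fin n) (Fin n) ℝ) (B : Matrix (Fin n) (Fin p) ℝ)
    (C : Matrix (Fin m) (Fin n) ℝ) (I : Set ℝ) : Submodule ℝ (EuclideanSpace ℝ (Fin n) ×
      Signal (EuclideanSpace ℝ (Fin p)) (EuclideanSpace ℝ (Fin m))) :=
  outputRelation (matCLM A) (matCLM B) (matCLM C) I

theorem IsSolution.memLp_output (h : IsSolution A B I ξ u x) (hI : MeasurableSet I)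
    (hc : cost C I u x ≠ ∞) : MemLp (fun s => matAct C (x s)) 2 (volume.restrict I) := by
  refine ⟨((continuous_matAct C).comp_continuousOn h.continuousOn).aestronglyMeasurable hI,
    lt_top_iff_ne_top.2 fun htop => hc ?_⟩
  rw [cost_eq_eLpNorm_sq_add h.memLp.1, htop, ENNReal.top_pow two_ne_zero, add_top]

theorem IsSolution.exists_mem_signalRelation (h : IsSolution A B I ξ u x) (hI : I.OrdConnected)
    (h0 : IsLeast I 0) (hc : cost C I u x ≠ ∞) :
    ∃ g, (ξ, g) ∈ signalRelation A B C I ∧ ENNReal.ofReal (‖g‖ ^ 2) = cost C I u x ∧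
      g.fst =ᵐ[volume.restrict I] u := by
  have hI0 : I ⊆ Ici 0 := fun s hs => h0.2 hs
  obtain ⟨v, hvu, hv⟩ := exists_Lp_zero_extension hI.measurableSet hI0 h.memLp
  obtain ⟨y, hyx, hy⟩ := exists_Lp_zero_extension hI.measurableSet hI0
    (h.memLp_output hI.measurableSet hc)
  refine ⟨WithLp.toLp 2 (v, y), mem_outputRelation_iff.2 (ae_restrict_of_ae ?_), ?_, hvu⟩
  · filter_upwards [(ae_restrict_iff' hI.measurableSet).1 hyx] with s hys hs
    have hsub : Ioc 0 s ⊆ I := Ioc_subset_Icc_self.trans (hI.out h0.1 hs)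
    refine (hys hs).trans ?_
    rw [← matCLM_apply, h.eqOn_mildSolution hI h0 hs]
    refine congrArg _ (mildSolution_congr _ _ (h0.2 hs) ?_)
    exact (ae_restrict_of_ae_restrict_of_subset hsub hvu).mono fun r hr =>
      congrArg (matCLM B) hr.symm
  · rw [ofReal_norm_sq_signal, cost_eq_eLpNorm_sq_add h.memLp.1, ← hv, ← hy]
    rfl

theorem exists_cost_le_of_mem_signalRelation {g} (hg : (ξ, g) ∈ signalRelation A B C I)
    (hI : MeasurableSet I) (hI0 : I ⊆ Ici 0) :
    ∃ x, IsSolution A B I ξ g.fst x ∧ cost C I g.fst x ≤ ENNReal.ofReal (‖g‖ ^ 2) := by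
  have hsol := (isSolution_mildSolution (A := A) (B := B) (ξ := ξ) (Lp.memLp g.fst)).mono hI0
  refine ⟨_, hsol, ?_⟩
  have houtput : (fun s => matAct C (mildSolution (matCLM A) ξ (fun r => matCLM B (g.fst r)) s))
      =ᵐ[volume.restrict I] g.snd := by
    filter_upwards [ae_restrict_of_ae_restrict_of_subset hI0 (mem_outputRelation_iff.1 hg),
      ae_restrict_mem hI] with s hgs hs
    exact (hgs hs).symm
  rw [cost_eq_eLpNorm_sq_add hsol.memLp.1, eLpNorm_congr_ae houtput, ofReal_norm_sq_signal]
  gcongr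

theorem exists_isOperatorPart_signalRelation (hfin : FiniteCost A B C) (hI : I ⊆ Ici 0) :
    ∃ F, IsOperatorPart (signalRelation A B C I) F := by
  refine exists_isOperatorPart _ (isClosed_setOf_zero_mem_outputRelation _ _ _ _) fun ξ => ?_
  obtain ⟨u, x, hs, hc⟩ := hfin ξ
  obtain ⟨g, hg, -⟩ := hs.exists_mem_signalRelation ordConnected_Ici isLeast_Ici hc.ne
  exact ⟨g, outputRelation_anti hI hg⟩

section OperatorPart

variable {F : EuclideanSpace ℝ (Fin n) →ₗ[ℝ]
  Signal (EuclideanSpace ℝ (Fin p)) (EuclideanSpace ℝ (Fin m))}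

theorem value_eq_of_isOperatorPart (hF : IsOperatorPart (signalRelation A B C I) F)
    (hI : I.OrdConnected) (h0 : IsLeast I 0) (ξ : EuclideanSpace ℝ (Fin n)) :
    value A B C I ξ = ENNReal.ofReal (‖F ξ‖ ^ 2) := by
  refine le_antisymm ?_ (le_value fun u x h => ?_)
  · obtain ⟨x, hs, hle⟩ := exists_cost_le_of_mem_signalRelation (hF.mem ξ) hI.measurableSet
      fun s hs => h0.2 hs
    exact (value_le_cost hs).trans hle
  · by_cases hc : cost C I u x = ∞
    · exact hc ▸ le_top
    obtain ⟨g, hg, hgc, -⟩ := h.exists_mem_signalRelation hI h0 hc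
    exact hgc ▸ ENNReal.ofReal_le_ofReal (hF.norm_sq_le hg)

theorem isValueMatrix_gramMatrix (hF : IsOperatorPart (signalRelation A B C I) F)
    (hI : I.OrdConnected) (h0 : IsLeast I 0) : IsValueMatrix A B C I (gramMatrix F) where
  isSymm := isSymm_gramMatrix F
  value_ne_top ξ := value_eq_of_isOperatorPart hF hI h0 ξ ▸ ENNReal.ofReal_ne_top
  inner_eq ξ := by
    rw [value_eq_of_isOperatorPart hF hI h0, ENNReal.toReal_ofReal (sq_nonneg _),
      inner_matAct_gramMatrix_self]

theorem exists_isOptimal (hF : IsOperatorPart (signalRelation A B C I) F) (hI : I.OrdConnected)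
    (h0 : IsLeast I 0) (ξ : EuclideanSpace ℝ (Fin n)) : ∃ u x, IsOptimal A B C I ξ u x := by
  obtain ⟨x, hs, hle⟩ := exists_cost_le_of_mem_signalRelation (hF.mem ξ) hI.measurableSet
    fun s hs => h0.2 hs
  exact ⟨_, x, hs, (hle.trans_eq (value_eq_of_isOperatorPart hF hI h0 ξ).symm).antisymm
    (value_le_cost hs)⟩

theorem IsOptimal.ae_eq_fst (hF : IsOperatorPart (signalRelation A B C I) F)
    (hI : I.OrdConnected) (h0 : IsLeast I 0) (ho : IsOptimal A B C I ξ u x) :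
    u =ᵐ[volume.restrict I] (F ξ).fst := by
  have hcost : cost C I u x = ENNReal.ofReal (‖F ξ‖ ^ 2) :=
    ho.cost_eq.trans (value_eq_of_isOperatorPart hF hI h0 ξ)
  obtain ⟨g, hg, hgc, hgu⟩ := ho.isSolution.exists_mem_signalRelation hI h0
    (hcost ▸ ENNReal.ofReal_ne_top)
  have hnorm : ‖g‖ ^ 2 = ‖F ξ‖ ^ 2 :=
    (ENNReal.ofReal_eq_ofReal_iff (sq_nonneg _) (sq_nonneg _)).1 (hgc.trans hcost)
  exact hF.eq_of_norm_sq_le hg hnorm.le ▸ hgu.symm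

theorem IsOptimal.ae_eq_and_eqOn (hF : IsOperatorPart (signalRelation A B C I) F)
    (hI : I.OrdConnected) (h0 : IsLeast I 0) (ho : IsOptimal A B C I ξ u x)
    (ho' : IsOptimal A B C I ξ u' x') : u =ᵐ[volume.restrict I] u' ∧ EqOn x x' I := by
  have hu : u =ᵐ[volume.restrict I] u' :=
    (ho.ae_eq_fst hF hI h0).trans (ho'.ae_eq_fst hF hI h0).symm
  exact ⟨hu, ho.isSolution.eqOn_of_ae_eq ho'.isSolution hI h0 hu⟩

theorem exists_tendsto_gramMatrix (hfin : FiniteCost A B C)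
    (hF : IsOperatorPart (signalRelation A B C (Ici 0)) F) :
    ∃ PT : ℝ → Matrix (Fin n) (Fin n) ℝ,
      (∀ T : ℝ, 0 < T → IsValueMatrix A B C (Icc 0 T) (PT T)) ∧
      Tendsto PT atTop (𝓝 (gramMatrix F)) := by
  choose G hG using fun T : ℝ =>
    exists_isOperatorPart_signalRelation hfin (I := Icc 0 T) Icc_subset_Ici_self
  refine ⟨fun T => gramMatrix (G T), fun T hT =>
    isValueMatrix_gramMatrix (hG T) ordConnected_Icc (isLeast_Icc hT.le), tendsto_gramMatrix ?_⟩
  rw [signalRelation, outputRelation_Ici_eq_iInf] at hF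
  exact IsOperatorPart.tendsto_iInf (fun _ _ hST => outputRelation_anti (Icc_subset_Icc_right hST))
    (fun _ => isClosed_setOf_zero_mem_outputRelation _ _ _ _) hG hF

end OperatorPart

theorem IsValueMatrix.unique {P Q : Matrix (Fin n) (Fin n) ℝ} (hP : IsValueMatrix A B C I P)
    (hQ : IsValueMatrix A B C I Q) : Q = P := by
  refine sub_eq_zero.1 (eq_zero_of_isSymm_of_inner_matAct_self (hQ.isSymm.sub hP.isSymm)
    fun ξ => ?_)
  rw [matAct_sub, inner_sub_left, hP.inner_eq, hQ.inner_eq, sub_self]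

end LQ

section Translation

variable {F : Type*} [NormedAddCommGroup F] {q : ℝ≥0∞} {a h : ℝ}

theorem measurePreserving_add_right_Ici (a h : ℝ) : MeasurePreserving (fun s : ℝ => s + h)
    (volume.restrict (Ici (a - h))) (volume.restrict (Ici a)) := by
  simpa only [preimage_add_const_Ici] using
    (measurePreserving_add_right volume h).restrict_preimage (measurableSet_Ici (a := a))

theorem memLp_comp_add_right_Ici {f : ℝ → F} (hf : MemLp f q (volume.restrict (Ici a))) (h : ℝ) :
    MemLp (fun s => f (s + h)) q (volume.restrict (Ici (a - h))) :=
  hf.comp_measurePreserving (measurePreserving_add_right_Ici a h)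

theorem exists_memLp_concat {f g : ℝ → F} (hf : MemLp f q (volume.restrict (Icc a h)))
    (hg : MemLp g q (volume.restrict (Ici 0))) :
    ∃ k, MemLp k q (volume.restrict (Ici a)) ∧ EqOn k f (Icc a h) ∧
      EqOn (fun s => k (s + h)) g (Ioi 0) := by
  refine ⟨(Iic h).piecewise f fun s => g (s + -h), MemLp.piecewise measurableSet_Iic ?_ ?_,
    fun s hs => piecewise_eq_of_mem _ _ _ hs.2, fun s hs => ?_⟩
  · rwa [Measure.restrict_restrict measurableSet_Iic, inter_comm, Ici_inter_Iic]
  · refine (memLp_comp_add_right_Ici hg (-h)).mono_measure ?_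
    rw [Measure.restrict_restrict measurableSet_Iic.compl, compl_Iic, zero_sub, neg_neg]
    exact Measure.restrict_mono (inter_subset_left.trans Ioi_subset_Ici_self) le_rfl
  · have hs' : s + h ∉ Iic h := by simpa using hs
    simp only [piecewise_eq_of_notMem _ _ _ hs', add_neg_cancel_right]

end Translation

namespace LQ

variable {n p m : ℕ} {A : Matrix (Fin n) (Fin n) ℝ} {B : Matrix (Fin n) (Fin p) ℝ}
  {C : Matrix (Fin m) (Fin n) ℝ} {I : Set ℝ} {ξ : EuclideanSpace ℝ (Fin n)} {h : ℝ}
  {u u' : ℝ → EuclideanSpace ℝ (Fin p)} {x x' : ℝ → EuclideanSpace ℝ (Fin n)}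

theorem IsSolution.integrableOn_rhs (hs : IsSolution A B (Icc 0 h) ξ u x) :
    IntegrableOn (fun s => matAct A (x s) + matAct B (u s)) (Ioc 0 h) :=
  (((continuous_matAct A).comp_continuousOn hs.continuousOn).integrableOn_Icc.mono_set
    Ioc_subset_Icc_self).add ((matCLM B).integrable_comp
      (integrableOn_Ioc_of_memLp_two Ioc_subset_Icc_self hs.memLp))

theorem IsSolution.apply_zero (hs : IsSolution A B I ξ u x) (h0 : 0 ∈ I) : x 0 = ξ := by
  simpa using hs.eq_integral 0 h0

theorem IsSolution.shift (hs : IsSolution A B (Ici 0) ξ u x) (hh : 0 ≤ h) :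
    IsSolution A B (Ici 0) (x h) (fun s => u (s + h)) (fun s => x (s + h)) where
  memLp := by
    simpa only [sub_self] using memLp_comp_add_right_Ici
      (hs.memLp.mono_measure (Measure.restrict_mono (Ici_subset_Ici.2 hh) le_rfl)) h
  continuousOn := hs.continuousOn.comp (by fun_prop) fun _ ht => add_nonneg ht hh
  eq_integral t ht := by
    have hth : h ≤ t + h := le_add_of_nonneg_left ht
    have hint : IntegrableOn (fun s => matAct A (x s) + matAct B (u s)) (Ioc 0 (t + h)) :=
      (hs.mono Icc_subset_Ici_self).integrableOn_rhs
    rw [hs.eq_integral (t + h) (hh.trans hth), hs.eq_integral h hh, add_assoc,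
      intervalIntegral.integral_comp_add_right fun s => matAct A (x s) + matAct B (u s), zero_add,
      intervalIntegral.integral_add_adjacent_intervals]
    · exact (intervalIntegrable_iff_integrableOn_Ioc_of_le hh).2
        (hint.mono_set (Ioc_subset_Ioc_right hth))
    · exact (intervalIntegrable_iff_integrableOn_Ioc_of_le hth).2
        (hint.mono_set (Ioc_subset_Ioc_left hh))

theorem cost_congr (hI : MeasurableSet I) (hu : u =ᵐ[volume.restrict I] u') (hx : EqOn x x' I) :
    cost C I u x = cost C I u' x' := by
  refine lintegral_congr_ae ?_
  filter_upwards [hu, ae_restrict_mem hI] with s hus hs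
  rw [hus, hx hs]

theorem cost_Ici_eq_add (C : Matrix (Fin m) (Fin n) ℝ) (u : ℝ → EuclideanSpace ℝ (Fin p))
    (x : ℝ → EuclideanSpace ℝ (Fin n)) (hh : 0 ≤ h) : cost C (Ici 0) u x =
      cost C (Icc 0 h) u x + cost C (Ici 0) (fun s => u (s + h)) (fun s => x (s + h)) := by
  have hshift := (measurePreserving_add_right_Ici h h).lintegral_comp_emb
    (measurableEmbedding_addRight h) fun s => ENNReal.ofReal (‖matAct C (x s)‖ ^ 2 + ‖u s‖ ^ 2)
  rw [sub_self] at hshift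
  simp only [cost]
  rw [hshift, setLIntegral_congr Ico_ae_eq_Icc.symm, ← lintegral_union measurableSet_Ici
    (disjoint_left.2 fun s hs hs' => hs.2.not_ge hs'), Ico_union_Ici_eq_Ici hh]

theorem IsSolution.exists_concat (hs : IsSolution A B (Icc 0 h) ξ u x) (hh : 0 ≤ h)
    (hs' : IsSolution A B (Ici 0) (x h) u' x') : ∃ v y, IsSolution A B (Ici 0) ξ v y ∧
      (v =ᵐ[volume.restrict (Icc 0 h)] u ∧ EqOn y x (Icc 0 h)) ∧
      (fun s => v (s + h)) =ᵐ[volume.restrict (Ici 0)] u' ∧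
        EqOn (fun s => y (s + h)) x' (Ici 0) := by
  obtain ⟨v, hv, hvu, hvu'⟩ := exists_memLp_concat hs.memLp hs'.memLp
  have hy := isSolution_mildSolution (A := A) (B := B) (ξ := ξ) hv
  have hleft : v =ᵐ[volume.restrict (Icc 0 h)] u := ae_restrict_of_forall_mem measurableSet_Icc hvu
  have hright : (fun s => v (s + h)) =ᵐ[volume.restrict (Ici 0)] u' := by
    rw [← restrict_Ioi_eq_restrict_Ici]
    exact ae_restrict_of_forall_mem measurableSet_Ioi hvu'
  have hyx := (hy.mono Icc_subset_Ici_self).eqOn_of_ae_eq hs ordConnected_Icc (isLeast_Icc hh) hleft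
  refine ⟨v, _, hy, ⟨hleft, hyx⟩, hright, ?_⟩
  have hyh := hy.shift hh
  rw [hyx ⟨hh, le_rfl⟩] at hyh
  exact hyh.eqOn_of_ae_eq hs' ordConnected_Ici isLeast_Ici hright

theorem IsSolution.value_le_cost_add_value (hs : IsSolution A B (Icc 0 h) ξ u x) (hh : 0 ≤ h) :
    value A B C (Ici 0) ξ ≤ cost C (Icc 0 h) u x + value A B C (Ici 0) (x h) := by
  refine tsub_le_iff_left.1 (le_value fun u' x' hs' => tsub_le_iff_left.2 ?_)
  obtain ⟨v, y, hy, ⟨hvu, hyx⟩, hvu', hyx'⟩ := hs.exists_concat hh hs'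
  refine (value_le_cost hy).trans_eq ?_
  rw [cost_Ici_eq_add C v y hh, cost_congr measurableSet_Icc hvu hyx,
    cost_congr measurableSet_Ici hvu' hyx']

theorem IsOptimal.cost_add_value_le (ho : IsOptimal A B C (Ici 0) ξ u x) (hh : 0 ≤ h) :
    cost C (Icc 0 h) u x + value A B C (Ici 0) (x h) ≤ value A B C (Ici 0) ξ := by
  rw [← ho.cost_eq, cost_Ici_eq_add C u x hh]
  gcongr
  exact value_le_cost (ho.isSolution.shift hh)

end LQ

theorem nonneg_of_eventually_integral_nonneg {φ : ℝ → ℝ} {a : ℝ} (hφ : ContinuousOn φ (Ici a))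
    (h : ∀ᶠ t in 𝓝[>] a, 0 ≤ ∫ s in a..t, φ s) : 0 ≤ φ a := by
  have hcont : ContinuousWithinAt φ (Ioi a) a := (hφ a self_mem_Ici).mono Ioi_subset_Ici_self
  have hmeas : StronglyMeasurableAtFilter φ (𝓝[>] a) :=
    ⟨Ioi a, self_mem_nhdsWithin, (hφ.mono Ioi_subset_Ici_self).aestronglyMeasurable
      measurableSet_Ioi⟩
  have hderiv := intervalIntegral.integral_hasDerivWithinAt_right (s := Ici a)
    (IntervalIntegrable.refl (f := φ) (μ := volume)) hmeas hcont
  have hslope := (hasDerivWithinAt_iff_tendsto_slope' self_notMem_Ioi).1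
    (hderiv.mono Ioi_subset_Ici_self)
  refine ge_of_tendsto hslope ?_
  filter_upwards [h, self_mem_nhdsWithin] with t ht hat
  rw [slope_def_field, intervalIntegral.integral_same, sub_zero]
  exact div_nonneg ht (sub_nonneg.2 (le_of_lt hat))

namespace LQ

variable {n p m : ℕ} {A : Matrix (Fin n) (Fin n) ℝ} {B : Matrix (Fin n) (Fin p) ℝ}
  {C : Matrix (Fin m) (Fin n) ℝ} {I : Set ℝ}
  {P : Matrix (Fin n) (Fin n) ℝ} {ξ : EuclideanSpace ℝ (Fin n)}
  {u : ℝ → EuclideanSpace ℝ (Fin p)} {x : ℝ → EuclideanSpace ℝ (Fin n)} {h : ℝ}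

/-- The left-hand side of the algebraic Riccati equation. -/
def riccati (A : Matrix (Fin n) (Fin n) ℝ) (B : Matrix (Fin n) (Fin p) ℝ)
    (C : Matrix (Fin m) (Fin n) ℝ) (P : Matrix (Fin n) (Fin n) ℝ) : Matrix (Fin n) (Fin n) ℝ :=
  Aᵀ * P + P * A - P * B * Bᵀ * P + Cᵀ * C

theorem isSymm_riccati (hP : P.IsSymm) : (riccati A B C P).IsSymm := by
  simp only [riccati, Matrix.IsSymm, Matrix.transpose_add, Matrix.transpose_sub,
    Matrix.transpose_mul, Matrix.transpose_transpose, hP.eq, Matrix.mul_assoc, add_comm]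

theorem inner_matAct_riccati (hP : P.IsSymm) (a : EuclideanSpace ℝ (Fin n)) :
    inner ℝ (matAct (riccati A B C P) a) a = ‖matAct C a‖ ^ 2 +
      2 * inner ℝ (matAct P a) (matAct A a) - ‖matAct Bᵀ (matAct P a)‖ ^ 2 := by
  simp only [riccati, matAct_add, matAct_sub, matAct_mul, inner_add_left, inner_sub_left]
  rw [inner_matAct_left Aᵀ, inner_matAct_left P (matAct A a), inner_matAct_left P (matAct B _),
    inner_matAct_left B, inner_matAct_left Cᵀ, Matrix.transpose_transpose,
    Matrix.transpose_transpose, hP.eq, real_inner_self_eq_norm_sq, real_inner_self_eq_norm_sq,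
    real_inner_comm (matAct A a)]
  ring

/-- The Hamiltonian of the problem at the state `a`, the control `b` and the costate `2 P a`: along
a solution it is the running cost plus the time derivative of `⟨P x, x⟩`. -/
noncomputable def hamiltonian (A : Matrix (Fin n) (Fin n) ℝ) (B : Matrix (Fin n) (Fin p) ℝ)
    (C : Matrix (Fin m) (Fin n) ℝ) (P : Matrix (Fin n) (Fin n) ℝ) (a : EuclideanSpace ℝ (Fin n))
    (b : EuclideanSpace ℝ (Fin p)) : ℝ :=
  ‖matAct C a‖ ^ 2 + ‖b‖ ^ 2 + 2 * inner ℝ (matAct P a) (matAct A a + matAct B b)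

theorem hamiltonian_eq_inner_riccati_add_sq (hP : P.IsSymm) (a : EuclideanSpace ℝ (Fin n))
    (b : EuclideanSpace ℝ (Fin p)) : hamiltonian A B C P a b =
      inner ℝ (matAct (riccati A B C P) a) a + ‖b + matAct Bᵀ (matAct P a)‖ ^ 2 := by
  rw [hamiltonian, inner_matAct_riccati hP, norm_add_sq_real, ← inner_matAct_left, inner_add_right,
    real_inner_comm (matAct P a)]
  ring

theorem IsSolution.integrableOn_running_cost (hs : IsSolution A B (Icc 0 h) ξ u x)
    (C : Matrix (Fin m) (Fin n) ℝ) :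
    IntegrableOn (fun s => ‖matAct C (x s)‖ ^ 2 + ‖u s‖ ^ 2) (Icc 0 h) :=
  (((continuous_matAct C).comp_continuousOn hs.continuousOn).norm.pow 2).integrableOn_Icc.add
    ((memLp_two_iff_integrable_sq_norm hs.memLp.1).1 hs.memLp)

theorem IsSolution.cost_eq_ofReal_integral (hs : IsSolution A B (Icc 0 h) ξ u x) (hh : 0 ≤ h) :
    cost C (Icc 0 h) u x =
      ENNReal.ofReal (∫ s in (0 : ℝ)..h, (‖matAct C (x s)‖ ^ 2 + ‖u s‖ ^ 2)) := by
  rw [intervalIntegral.integral_of_le hh, ← integral_Icc_eq_integral_Ioc, cost,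
    ofReal_integral_eq_lintegral_ofReal (hs.integrableOn_running_cost C)
      (Eventually.of_forall fun s => by positivity)]

theorem IsSolution.integral_hamiltonian (hs : IsSolution A B (Icc 0 h) ξ u x) (hP : P.IsSymm)
    (hh : 0 ≤ h) : IntervalIntegrable (fun s => hamiltonian A B C P (x s) (u s)) volume 0 h ∧
      ∫ s in (0 : ℝ)..h, hamiltonian A B C P (x s) (u s) =
        (∫ s in (0 : ℝ)..h, (‖matAct C (x s)‖ ^ 2 + ‖u s‖ ^ 2)) +
          (inner ℝ (matAct P (x h)) (x h) - inner ℝ (matAct P ξ) ξ) := by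
  let L := innerSL ℝ ∘L matCLM P
  have hL : ∀ a b, L a b = inner ℝ (matAct P a) b := fun _ _ => rfl
  obtain ⟨hint, hPx⟩ := intervalIntegrable_and_bilin_primitive_eq L hh hs.integrableOn_rhs
    hs.integrableOn_rhs hs.eq_integral hs.eq_integral
  have hcost := (intervalIntegrable_iff_integrableOn_Ioc_of_le hh).2
    ((hs.integrableOn_running_cost C).mono_set Ioc_subset_Icc_self)
  have hham : (fun s => hamiltonian A B C P (x s) (u s)) = fun s =>
      (‖matAct C (x s)‖ ^ 2 + ‖u s‖ ^ 2) +
        (L (matAct A (x s) + matAct B (u s)) (x s) +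
          L (x s) (matAct A (x s) + matAct B (u s))) := by
    funext s
    have hsymm : L (matAct A (x s) + matAct B (u s)) (x s) =
        L (x s) (matAct A (x s) + matAct B (u s)) := by
      rw [hL, hL, inner_matAct_left, hP.eq, real_inner_comm]
    rw [hsymm, ← two_mul]
    rfl
  have hdiff : inner ℝ (matAct P (x h)) (x h) - inner ℝ (matAct P ξ) ξ = _ :=
    sub_eq_iff_eq_add'.2 hPx
  rw [hham, hdiff, intervalIntegral.integral_add hcost hint]
  exact ⟨hcost.add hint, rfl⟩

theorem IsSolution.cost_Icc_ne_top (hs : IsSolution A B (Icc 0 h) ξ u x) (hh : 0 ≤ h) :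
    cost C (Icc 0 h) u x ≠ ∞ :=
  hs.cost_eq_ofReal_integral hh ▸ ENNReal.ofReal_ne_top

theorem IsSolution.toReal_cost_add_value (hs : IsSolution A B (Icc 0 h) ξ u x) (hh : 0 ≤ h)
    (hP : IsValueMatrix A B C I P) :
    (cost C (Icc 0 h) u x + value A B C I (x h)).toReal =
      (value A B C I ξ).toReal + ∫ s in (0 : ℝ)..h, hamiltonian A B C P (x s) (u s) := by
  have hrunning : 0 ≤ ∫ s in (0 : ℝ)..h, (‖matAct C (x s)‖ ^ 2 + ‖u s‖ ^ 2) :=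
    intervalIntegral.integral_nonneg hh fun s _ => by positivity
  rw [ENNReal.toReal_add (hs.cost_Icc_ne_top hh) (hP.value_ne_top _), hs.cost_eq_ofReal_integral hh,
    ENNReal.toReal_ofReal hrunning, ← hP.inner_eq, ← hP.inner_eq,
    (hs.integral_hamiltonian hP.isSymm hh).2]
  ring

theorem IsValueMatrix.integral_hamiltonian_nonneg (hP : IsValueMatrix A B C (Ici 0) P)
    (hs : IsSolution A B (Icc 0 h) ξ u x) (hh : 0 ≤ h) :
    0 ≤ ∫ s in (0 : ℝ)..h, hamiltonian A B C P (x s) (u s) := by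
  have hle := ENNReal.toReal_mono (ENNReal.add_ne_top.2 ⟨hs.cost_Icc_ne_top hh, hP.value_ne_top _⟩)
    (hs.value_le_cost_add_value hh)
  rwa [hs.toReal_cost_add_value hh hP, le_add_iff_nonneg_right] at hle

theorem IsValueMatrix.integral_hamiltonian_nonpos (hP : IsValueMatrix A B C (Ici 0) P)
    (ho : IsOptimal A B C (Ici 0) ξ u x) (hh : 0 ≤ h) :
    ∫ s in (0 : ℝ)..h, hamiltonian A B C P (x s) (u s) ≤ 0 := by
  have hle := ENNReal.toReal_mono (hP.value_ne_top ξ) (ho.cost_add_value_le hh)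
  rwa [(ho.isSolution.mono Icc_subset_Ici_self).toReal_cost_add_value hh hP,
    add_le_iff_nonpos_right] at hle

theorem continuous_hamiltonian_left (A : Matrix (Fin n) (Fin n) ℝ) (B : Matrix (Fin n) (Fin p) ℝ)
    (C : Matrix (Fin m) (Fin n) ℝ) (P : Matrix (Fin n) (Fin n) ℝ) (b : EuclideanSpace ℝ (Fin p)) :
    Continuous fun a => hamiltonian A B C P a b := by
  unfold hamiltonian
  fun_prop

theorem IsValueMatrix.inner_riccati_nonneg (hP : IsValueMatrix A B C (Ici 0) P)
    (ξ : EuclideanSpace ℝ (Fin n)) : 0 ≤ inner ℝ (matAct (riccati A B C P) ξ) ξ := by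
  set b := -matAct Bᵀ (matAct P ξ) with hb
  obtain ⟨x, hs⟩ : ∃ x, IsSolution A B (Ici 0) ξ ((Ioc 0 1).indicator fun _ => b) x :=
    ⟨_, isSolution_mildSolution (memLp_indicator_Ioc_of_continuous continuous_const 2 0 1)⟩
  have hnonneg : 0 ≤ hamiltonian A B C P (x 0) b := by
    refine nonneg_of_eventually_integral_nonneg (φ := fun s => hamiltonian A B C P (x s) b)
      ((continuous_hamiltonian_left A B C P b).comp_continuousOn hs.continuousOn) ?_
    filter_upwards [Ioc_mem_nhdsGT zero_lt_one] with t ht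
    refine (hP.integral_hamiltonian_nonneg (hs.mono Icc_subset_Ici_self) ht.1.le).trans_eq ?_
    simp only [intervalIntegral.integral_of_le ht.1.le]
    refine setIntegral_congr_fun measurableSet_Ioc fun s hst => ?_
    simp only [indicator_of_mem (Ioc_subset_Ioc_right ht.2 hst)]
  rw [hs.apply_zero self_mem_Ici, hamiltonian_eq_inner_riccati_add_sq hP.isSymm] at hnonneg
  simpa [hb] using hnonneg

theorem IsValueMatrix.inner_riccati_nonpos (hP : IsValueMatrix A B C (Ici 0) P)
    (ho : IsOptimal A B C (Ici 0) ξ u x) : inner ℝ (matAct (riccati A B C P) ξ) ξ ≤ 0 := by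
  have hcont : ContinuousOn (fun s => inner ℝ (matAct (riccati A B C P) (x s)) (x s)) (Ici 0) :=
    ((continuous_matAct _).comp_continuousOn ho.isSolution.continuousOn).inner
      ho.isSolution.continuousOn
  have hnonneg : 0 ≤ -inner ℝ (matAct (riccati A B C P) (x 0)) (x 0) := by
    refine nonneg_of_eventually_integral_nonneg (a := 0)
      (φ := fun s => -inner ℝ (matAct (riccati A B C P) (x s)) (x s)) hcont.neg ?_
    filter_upwards [self_mem_nhdsWithin] with t ht
    have hs : IsSolution A B (Icc 0 t) ξ u x := ho.isSolution.mono Icc_subset_Ici_self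
    have hint := (hcont.mono Icc_subset_Ici_self).intervalIntegrable_of_Icc (μ := volume)
      (le_of_lt ht)
    rw [intervalIntegral.integral_neg, neg_nonneg]
    refine (intervalIntegral.integral_mono_on (le_of_lt ht) hint
      (hs.integral_hamiltonian hP.isSymm (le_of_lt ht)).1 fun s _ => ?_).trans
      (hP.integral_hamiltonian_nonpos ho (le_of_lt ht))
    rw [hamiltonian_eq_inner_riccati_add_sq hP.isSymm]
    exact le_add_of_nonneg_right (sq_nonneg _)
  rwa [ho.isSolution.apply_zero self_mem_Ici, neg_nonneg] at hnonneg

theorem IsValueMatrix.riccati_eq_zero (hP : IsValueMatrix A B C (Ici 0) P)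
    (hex : ∀ ξ, ∃ u x, IsOptimal A B C (Ici 0) ξ u x) : riccati A B C P = 0 := by
  refine eq_zero_of_isSymm_of_inner_matAct_self (isSymm_riccati hP.isSymm) fun ξ => ?_
  obtain ⟨u, x, ho⟩ := hex ξ
  exact (hP.inner_riccati_nonpos ho).antisymm (hP.inner_riccati_nonneg ξ)

theorem IsValueMatrix.feedback_ae_Ioc (hP : IsValueMatrix A B C (Ici 0) P)
    (hR : riccati A B C P = 0) (ho : IsOptimal A B C (Ici 0) ξ u x) (hh : 0 ≤ h) :
    ∀ᵐ s ∂volume.restrict (Ioc 0 h), u s = -matAct Bᵀ (matAct P (x s)) := by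
  have hsq : ∀ s, hamiltonian A B C P (x s) (u s) = ‖u s + matAct Bᵀ (matAct P (x s))‖ ^ 2 :=
    fun s => by
      rw [hamiltonian_eq_inner_riccati_add_sq hP.isSymm, hR]
      simp [matAct]
  have hnonpos := hP.integral_hamiltonian_nonpos ho hh
  have hint := ((ho.isSolution.mono Icc_subset_Ici_self).integral_hamiltonian (C := C)
    hP.isSymm hh).1
  simp only [hsq] at hnonpos hint
  have hzero := hnonpos.antisymm (intervalIntegral.integral_nonneg hh fun s _ => sq_nonneg _)
  rw [intervalIntegral.integral_of_le hh, integral_eq_zero_iff_of_nonneg (fun s => sq_nonneg _)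
    ((intervalIntegrable_iff_integrableOn_Ioc_of_le hh).1 hint)] at hzero
  filter_upwards [hzero] with s hs
  exact eq_neg_of_add_eq_zero_left (norm_eq_zero.1 ((pow_eq_zero_iff two_ne_zero).1 hs))

theorem IsValueMatrix.feedback (hP : IsValueMatrix A B C (Ici 0) P) (hR : riccati A B C P = 0)
    (ho : IsOptimal A B C (Ici 0) ξ u x) :
    ∀ᵐ t ∂volume.restrict (Ici (0 : ℝ)), u t = -matAct Bᵀ (matAct P (x t)) := by
  rw [← restrict_Ioi_eq_restrict_Ici,
    ← iUnion_Ioc_eq_Ioi_self_iff.2 fun t _ => exists_nat_ge t, ae_restrict_iUnion_iff]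
  exact fun k : ℕ => hP.feedback_ae_Ioc hR ho k.cast_nonneg

end LQ

theorem theorem9p2 {n p m : ℕ} (A : Matrix (Fin n) (Fin n) ℝ) (B : Matrix (Fin n) (Fin p) ℝ)
    (C : Matrix (Fin m) (Fin n) ℝ) (hfin : LQ.FiniteCost A B C) :
    ∃ P : Matrix (Fin n) (Fin n) ℝ,
      -- `P` is the unique symmetric matrix with `⟨P ξ, ξ⟩` equal to the infinite-horizon value
      LQ.IsValueMatrix A B C (Ici 0) P ∧
      (∀ Q : Matrix (Fin n) (Fin n) ℝ, LQ.IsValueMatrix A B C (Ici 0) Q → Q = P) ∧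
      -- `P` is the limit of the finite-horizon value matrices (without final cost)
      (∃ PT : ℝ → Matrix (Fin n) (Fin n) ℝ,
        (∀ T : ℝ, 0 < T → LQ.IsValueMatrix A B C (Icc 0 T) (PT T)) ∧
        Tendsto PT atTop (𝓝 P)) ∧
      -- the optimal solution exists, is unique, and is given by the feedback `-Bᵀ P`
      (∀ ξ : EuclideanSpace ℝ (Fin n),
        (∃ (u : ℝ → EuclideanSpace ℝ (Fin p)) (x : ℝ → EuclideanSpace ℝ (Fin n)),
          LQ.IsOptimal A B C (Ici 0) ξ u x) ∧
        (∀ (u u' : ℝ → EuclideanSpace ℝ (Fin p)) (x x' : ℝ → EuclideanSpace ℝ (Fin n)),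
          LQ.IsOptimal A B C (Ici 0) ξ u x → LQ.IsOptimal A B C (Ici 0) ξ u' x' →
            u =ᵐ[volume.restrict (Ici 0)] u' ∧ EqOn x x' (Ici 0)) ∧
        (∀ (u : ℝ → EuclideanSpace ℝ (Fin p)) (x : ℝ → EuclideanSpace ℝ (Fin n)),
          LQ.IsOptimal A B C (Ici 0) ξ u x →
            ∀ᵐ t ∂(volume.restrict (Ici (0 : ℝ))), u t = -matAct Bᵀ (matAct P (x t)))) ∧
      -- the algebraic Riccati equation
      Aᵀ * P + P * A - P * B * Bᵀ * P + Cᵀ * C = 0 := by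
  obtain ⟨F, hF⟩ := LQ.exists_isOperatorPart_signalRelation hfin subset_rfl
  have hP := LQ.isValueMatrix_gramMatrix hF ordConnected_Ici isLeast_Ici
  have hex := LQ.exists_isOptimal hF ordConnected_Ici isLeast_Ici
  have hR := hP.riccati_eq_zero hex
  exact ⟨_, hP, fun Q hQ => hP.unique hQ, LQ.exists_tendsto_gramMatrix hfin hF,
    fun ξ => ⟨hex ξ, fun u u' x x' ho ho' => ho.ae_eq_and_eqOn hF ordConnected_Ici isLeast_Ici ho',
      fun u x ho => hP.feedback hR ho⟩, hR⟩
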